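/- **Theorem.** The only solution $(m,p,q,x)$ in positive integers $m,p,q,x$, with $p$ and $q$ odd primes, of the equation $$x^2+q^{2m}=2\cdot 17^p$$ is $(m,p,q,x)=(1,3,5,99)$. -/

import Mathlib

/-! Factor in ℤ[i], with 17 = (4 + i)(4 - i) and 2 = (1 + i)(1 - i). If 17 ∤ x, then x and q ^ m
are, up to order and sign, the two entries S, D of `gaussPair p` (`sq_eq_gaussPair_sq`); if 17 ∣ x,
then q = 17, which descent excludes (`sq_add_seventeen_pow_ne`). For odd p, one entry is divisible
by 3 and the other by 5, so q is 3 or 5. If q² divides its entry, periodicity mod 9 or 25 gives q ∣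
p, so p = q, and the residue of p mod 4 or another prime factor of the entry refutes this. Otherwise
m = 1 and the entry is ±q. A congruence mod 16 fixes the sign, and a 2-adic argument
(`gaussPair_add_four_mul_ne`) shows that no value recurs in the same entry within a class of p mod
4. The values (5, 3) at exponent 1 and (99, 5) at exponent 3 then leave only p = 3, q = 5; the case
of S = ±3 falls to a congruence mod 5. -/

/-- The pair `(re + im, re - im)` of the Gaussian integer `(4 + i) ^ n`. -/
def gaussPair : ℕ → ℤ × ℤ
  | 0 => (1, 1)
  | n + 1 => (4 * (gaussPair n).1 + (gaussPair n).2, 4 * (gaussPair n).2 - (gaussPair n).1)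

theorem gaussPair_succ_fst (n : ℕ) :
    (gaussPair (n + 1)).1 = 4 * (gaussPair n).1 + (gaussPair n).2 := rfl

theorem gaussPair_succ_snd (n : ℕ) :
    (gaussPair (n + 1)).2 = 4 * (gaussPair n).2 - (gaussPair n).1 := rfl

/-- Up to a unit, a solution of `x ^ 2 + y ^ 2 = 2 * 17 ^ n` lying on the branch of `4 + i`
is given by `gaussPair n`. -/
theorem eq_gaussPair_of_not_dvd (n : ℕ) : ∀ x y : ℤ, x ^ 2 + y ^ 2 = 2 * 17 ^ n →
    ¬ (17 : ℤ) ∣ 4 * x + y →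
    (x = (gaussPair n).1 ∧ y = (gaussPair n).2) ∨ (x = -(gaussPair n).1 ∧ y = -(gaussPair n).2) ∨
    (x = (gaussPair n).2 ∧ y = -(gaussPair n).1) ∨
    (x = -(gaussPair n).2 ∧ y = (gaussPair n).1) := by
  induction n with
  | zero =>
    intro x y h _
    have hx1 : x ≤ 1 := by nlinarith [sq_nonneg y]
    have hx2 : -1 ≤ x := by nlinarith [sq_nonneg y]
    have hy1 : y ≤ 1 := by nlinarith [sq_nonneg x]
    have hy2 : -1 ≤ y := by nlinarith [sq_nonneg x]
    interval_cases x <;> interval_cases y <;> simp [gaussPair] at h ⊢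
  | succ n ih =>
    intro x y h hxy
    have hp : Prime (17 : ℤ) := by norm_num
    have hd : (17 : ℤ) ∣ (4 * x + y) * (4 * x - y) :=
      ⟨x ^ 2 - 2 * 17 ^ n, by rw [pow_succ (17 : ℤ)] at h; linarith⟩
    -- Here 17 ∣ 4x - y allows division by 4 + i, with quotient pair (a, b). The four alternatives
    -- of the conclusion are the units ±1, ±i.
    obtain ⟨a, ha⟩ := (hp.dvd_or_dvd hd).resolve_left hxy
    obtain ⟨b, hb⟩ : (17 : ℤ) ∣ 4 * y + x := by omega
    obtain rfl : x = 4 * a + b := by linarith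
    obtain rfl : y = 4 * b - a := by linarith
    have hab : a ^ 2 + b ^ 2 = 2 * 17 ^ n := by
      rw [pow_succ (17 : ℤ)] at h; linarith
    have := ih a b hab (by omega)
    rw [gaussPair_succ_fst, gaussPair_succ_snd]
    omega

/-- 17 cannot divide both 4x + y and 4x - y, since their sum is 8x; changing the sign of y
(conjugation up to a unit) reaches the right branch. -/
theorem sq_eq_gaussPair_sq {n : ℕ} {x y : ℤ} (h : x ^ 2 + y ^ 2 = 2 * 17 ^ n)
    (hx : ¬ (17 : ℤ) ∣ x) :
    (x ^ 2 = (gaussPair n).1 ^ 2 ∧ y ^ 2 = (gaussPair n).2 ^ 2) ∨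
    (x ^ 2 = (gaussPair n).2 ^ 2 ∧ y ^ 2 = (gaussPair n).1 ^ 2) := by
  by_cases hc : (17 : ℤ) ∣ 4 * x + y
  · have := eq_gaussPair_of_not_dvd n x (-y) (by rw [neg_sq, h]) (by omega)
    rw [← neg_sq y]
    rcases this with ⟨h1, h2⟩ | ⟨h1, h2⟩ | ⟨h1, h2⟩ | ⟨h1, h2⟩ <;> simp [h1, h2]
  · rcases eq_gaussPair_of_not_dvd n x y h hc with ⟨h1, h2⟩ | ⟨h1, h2⟩ | ⟨h1, h2⟩ | ⟨h1, h2⟩ <;>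
      simp [h1, h2]

/-! ### Congruences for the powers of 4 + i -/

theorem gaussPair_modEq {M : ℤ} {T : ℕ} (h1 : (gaussPair T).1 ≡ 1 [ZMOD M])
    (h2 : (gaussPair T).2 ≡ 1 [ZMOD M]) (n : ℕ) :
    (gaussPair n).1 ≡ (gaussPair (n % T)).1 [ZMOD M] ∧
    (gaussPair n).2 ≡ (gaussPair (n % T)).2 [ZMOD M] := by
  have step : ∀ r, (gaussPair (r + T)).1 ≡ (gaussPair r).1 [ZMOD M] ∧
      (gaussPair (r + T)).2 ≡ (gaussPair r).2 [ZMOD M] := by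
    intro r
    induction r with
    | zero => simpa [gaussPair] using ⟨h1, h2⟩
    | succ r ih =>
      rw [Nat.add_right_comm]
      exact ⟨(ih.1.mul_left 4).add ih.2, (ih.2.mul_left 4).sub ih.1⟩
  have mult : ∀ k r, (gaussPair (r + T * k)).1 ≡ (gaussPair r).1 [ZMOD M] ∧
      (gaussPair (r + T * k)).2 ≡ (gaussPair r).2 [ZMOD M] := by
    intro k r
    induction k with
    | zero => exact ⟨rfl, rfl⟩
    | succ k ih =>
      rw [Nat.mul_succ, ← add_assoc]
      exact ⟨(step _).1.trans ih.1, (step _).2.trans ih.2⟩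
  have := mult (n / T) (n % T)
  rwa [Nat.mod_add_div] at this

theorem gaussPair_mod_sixteen (n : ℕ) :
    (n % 4 = 1 → (gaussPair n).1 % 16 = 5 ∧ (gaussPair n).2 % 16 = 3) ∧
    (n % 4 = 3 → (gaussPair n).1 % 16 = 3 ∧ (gaussPair n).2 % 16 = 5) := by
  obtain ⟨h1, h2⟩ := gaussPair_modEq (M := 16) (T := 4) (by decide) (by decide) n
  rw [Int.ModEq] at h1 h2
  constructor <;> intro h <;> rw [h1, h2, h] <;> decide

theorem gaussPair_odd (n : ℕ) : (gaussPair n).1 % 2 = 1 ∧ (gaussPair n).2 % 2 = 1 := by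
  induction n with
  | zero => decide
  | succ n ih =>
    rw [gaussPair_succ_fst, gaussPair_succ_snd]
    omega

theorem gaussPair_dvd_fifteen (n : ℕ) :
    (n % 4 = 1 → (5 : ℤ) ∣ (gaussPair n).1 ∧ (3 : ℤ) ∣ (gaussPair n).2) ∧
    (n % 4 = 3 → (3 : ℤ) ∣ (gaussPair n).1 ∧ (5 : ℤ) ∣ (gaussPair n).2) := by
  obtain ⟨h1, h2⟩ := gaussPair_modEq (M := 15) (T := 8) (by decide) (by decide) n
  rw [Int.modEq_iff_dvd] at h1 h2
  have hr : n % 4 = n % 8 % 4 := by omega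
  have hlt : n % 8 < 8 := by omega
  rw [hr]
  generalize n % 8 = r at *
  interval_cases r <;> simp [gaussPair] at h1 h2 ⊢ <;> omega

theorem five_dvd_of_twentyfive_dvd (n : ℕ) :
    (n % 4 = 1 → (25 : ℤ) ∣ (gaussPair n).1 → 5 ∣ n) ∧
    (n % 4 = 3 → (25 : ℤ) ∣ (gaussPair n).2 → 5 ∣ n) := by
  obtain ⟨h1, h2⟩ := gaussPair_modEq (M := 25) (T := 20) (by decide) (by decide) n
  rw [h1.dvd_iff, h2.dvd_iff]
  have hr : n % 4 = n % 20 % 4 := by omega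
  have hs : 5 ∣ n ↔ 5 ∣ n % 20 := by omega
  have hlt : n % 20 < 20 := by omega
  rw [hr, hs]
  generalize n % 20 = r at hlt
  clear h1 h2 hr hs
  revert hlt
  revert r
  decide

theorem three_dvd_of_nine_dvd (n : ℕ) :
    (n % 4 = 1 → (9 : ℤ) ∣ (gaussPair n).2 → 3 ∣ n) ∧
    (n % 4 = 3 → (9 : ℤ) ∣ (gaussPair n).1 → 3 ∣ n) := by
  obtain ⟨h1, h2⟩ := gaussPair_modEq (M := 9) (T := 24) (by decide) (by decide) n
  rw [h1.dvd_iff, h2.dvd_iff]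
  have hr : n % 4 = n % 24 % 4 := by omega
  have hs : 3 ∣ n ↔ 3 ∣ n % 24 := by omega
  have hlt : n % 24 < 24 := by omega
  rw [hr, hs]
  generalize n % 24 = r at hlt
  clear h1 h2 hr hs
  revert hlt
  revert r
  decide

/-! ### Non-recurrence by 2-adic expansion -/

/-- The 2-adic expansion of `(4 + i) ^ (4 * k)` around `1`, as an action on `gaussPair`. -/
theorem exists_gaussPair_add_four_mul (k : ℕ) : 0 < k → ∃ (e : ℕ) (a b : ℤ), ∀ n,
    (gaussPair (n + 4 * k)).1 = (gaussPair n).1 +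
      16 * 2 ^ e * (2 * a * (gaussPair n).1 + (2 * b + 1) * (gaussPair n).2) ∧
    (gaussPair (n + 4 * k)).2 = (gaussPair n).2 +
      16 * 2 ^ e * (2 * a * (gaussPair n).2 - (2 * b + 1) * (gaussPair n).1) := by
  -- (4 + i)^4 = 161 + 240i = 1 + 16(10 + 15i).
  have one : ∀ n, (gaussPair (n + 4)).1 = 161 * (gaussPair n).1 + 240 * (gaussPair n).2 ∧
      (gaussPair (n + 4)).2 = 161 * (gaussPair n).2 - 240 * (gaussPair n).1 := by
    intro n
    simp only [gaussPair]
    constructor <;> ring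
  have double : ∀ (j e : ℕ) (a b : ℤ), (∀ n,
      (gaussPair (n + 4 * j)).1 = (gaussPair n).1 +
        16 * 2 ^ e * (2 * a * (gaussPair n).1 + (2 * b + 1) * (gaussPair n).2) ∧
      (gaussPair (n + 4 * j)).2 = (gaussPair n).2 +
        16 * 2 ^ e * (2 * a * (gaussPair n).2 - (2 * b + 1) * (gaussPair n).1)) →
      ∃ a' b' : ℤ, ∀ n,
      (gaussPair (n + 4 * (2 * j))).1 = (gaussPair n).1 +
        16 * 2 ^ (e + 1) * (2 * a' * (gaussPair n).1 + (2 * b' + 1) * (gaussPair n).2) ∧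
      (gaussPair (n + 4 * (2 * j))).2 = (gaussPair n).2 +
        16 * 2 ^ (e + 1) * (2 * a' * (gaussPair n).2 - (2 * b' + 1) * (gaussPair n).1) := by
    intro j e a b h
    -- With t = 16 · 2^e and u = 2a + (2b + 1)i, (1 + tu)² = 1 + 2t(u + (t/2)u²); the witnesses are
    -- read off from u + (t/2)u².
    refine ⟨a + 4 * 2 ^ e * (4 * a ^ 2 - (2 * b + 1) ^ 2),
      b + 16 * 2 ^ e * a * (2 * b + 1), fun n => ?_⟩
    have e1 : n + 4 * (2 * j) = n + 4 * j + 4 * j := by ring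
    rw [e1, (h (n + 4 * j)).1, (h (n + 4 * j)).2, (h n).1, (h n).2]
    constructor <;> ring
  induction k using Nat.strong_induction_on with
  | _ k ih =>
    intro hk
    rcases Nat.even_or_odd' k with ⟨j, rfl | rfl⟩
    · obtain ⟨e, a, b, h⟩ := ih j (by omega) (by omega)
      obtain ⟨a', b', h'⟩ := double j e a b h
      exact ⟨e + 1, a', b', h'⟩
    · rcases Nat.eq_zero_or_pos j with rfl | hj
      · refine ⟨0, 5, 7, fun n => ?_⟩
        rw [mul_zero, zero_add, mul_one, (one n).1, (one n).2]
        constructor <;> ring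
      · obtain ⟨e, a, b, h⟩ := ih j (by omega) hj
        obtain ⟨a', b', h'⟩ := double j e a b h
        -- For odd k the factor 1 + 16(10 + 15i) dominates: the other factor is 1 mod 32, so the
        -- imaginary coefficient stays odd.
        refine ⟨0, 5 + 2 ^ e * (161 * (2 * a') - 240 * (2 * b' + 1)),
          7 + 2 ^ e * (161 * (2 * b' + 1) + 240 * (2 * a')), fun n => ?_⟩
        have e1 : n + 4 * (2 * j + 1) = n + 4 * (2 * j) + 4 := by ring
        rw [e1, (one _).1, (one _).2, (h' n).1, (h' n).2]
        constructor <;> ring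

/-- The difference is a power of 2 times an odd number, because both entries are odd. -/
theorem gaussPair_add_four_mul_ne (n : ℕ) {k : ℕ} (hk : 0 < k) :
    (gaussPair (n + 4 * k)).1 ≠ (gaussPair n).1 ∧
    (gaussPair (n + 4 * k)).2 ≠ (gaussPair n).2 := by
  obtain ⟨e, a, b, h⟩ := exists_gaussPair_add_four_mul k hk
  obtain ⟨o1, o2⟩ := gaussPair_odd n
  rw [(h n).1, (h n).2]
  have h2 : (16 * 2 ^ e : ℤ) ≠ 0 := by positivity
  have odd1 : ∀ s t : ℤ, t % 2 = 1 → 2 * a * s + (2 * b + 1) * t ≠ 0 := by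
    intro s t ht h0
    have : t = 2 * (-(a * s) - b * t) := by linarith
    omega
  refine ⟨fun h0 => ?_, fun h0 => ?_⟩
  · exact (mul_ne_zero h2 (odd1 (gaussPair n).1 _ o2)) (by linarith)
  · exact (mul_ne_zero h2 (odd1 (gaussPair n).2 (-(gaussPair n).1) (by omega))) (by linarith)

/-- Descent: 17 ∣ x, and dividing by 17² lowers m by 1 and n by 2. It ends at x² + 1 = 2 · 17^n,
impossible because each entry is divisible by 3 or 5. -/
theorem sq_add_seventeen_pow_ne (m : ℕ) : ∀ (x : ℤ) (n : ℕ), Odd n →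
    x ^ 2 + 17 ^ (2 * m) ≠ 2 * 17 ^ n := by
  have hp : Prime (17 : ℤ) := by norm_num
  induction m with
  | zero =>
    intro x n hn h
    have hx : ¬ (17 : ℤ) ∣ x := by
      rintro ⟨c, rfl⟩
      obtain ⟨k, rfl⟩ := hn
      have : (1 : ℤ) = 17 * (2 * 17 ^ (2 * k) - 17 * c ^ 2) := by
        rw [pow_succ (17 : ℤ), mul_zero, pow_zero] at h; linarith
      omega
    have hsq : ∀ z : ℤ, (1 : ℤ) ^ 2 = z ^ 2 → ¬ (3 : ℤ) ∣ z ∧ ¬ (5 : ℤ) ∣ z := by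
      intro z hz
      rcases sq_eq_sq_iff_eq_or_eq_neg.mp hz with h | h <;> omega
    have hd := gaussPair_dvd_fifteen n
    have hn4 : n % 4 = 1 ∨ n % 4 = 3 := by rcases hn with ⟨k, rfl⟩; omega
    rcases sq_eq_gaussPair_sq (y := 1) (by simpa using h) hx with ⟨-, h2⟩ | ⟨-, h2⟩ <;>
      have := hsq _ h2 <;> tauto
  | succ m ih =>
    intro x n hn h
    obtain ⟨k, rfl⟩ := hn
    rcases k with _ | k
    · have h1 : (1 : ℤ) ≤ 17 ^ (2 * m) := one_le_pow₀ (by norm_num)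
      have e1 : (17 : ℤ) ^ (2 * (m + 1)) = 17 ^ (2 * m) * 289 := by ring
      rw [e1] at h
      norm_num at h
      nlinarith [sq_nonneg x]
    · have hx : (17 : ℤ) ∣ x := by
        refine hp.dvd_of_dvd_pow (n := 2)
          ⟨2 * 17 ^ (2 * k + 2) - 17 ^ (2 * m + 1), ?_⟩
        ring_nf at h ⊢
        linarith
      obtain ⟨c, rfl⟩ := hx
      refine ih c (2 * k + 1) ⟨k, rfl⟩ ?_
      ring_nf at h ⊢
      linarith

theorem prime_eq_of_dvd_of_sq_eq {q m r : ℕ} (hq : q.Prime) (hr : r.Prime) {z : ℤ}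
    (h : ((q : ℤ) ^ m) ^ 2 = z ^ 2) (hz : (r : ℤ) ∣ z) : r = q := by
  have h1 : r ∣ q ^ m := by
    have h2 := hz.trans (dvd_pow_self z two_ne_zero)
    rw [← h] at h2
    exact hr.dvd_of_dvd_pow (n := 2) (by exact_mod_cast h2)
  exact (Nat.prime_dvd_prime_iff_eq hr hq).mp (hr.dvd_of_dvd_pow h1)

theorem sq_dvd_or_eq_one {q m : ℕ} (hm : 0 < m) {z : ℤ}
    (h : ((q : ℤ) ^ m) ^ 2 = z ^ 2) : (q : ℤ) ^ 2 ∣ z ∨ m = 1 ∧ (z = q ∨ z = -q) := by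
  rcases Nat.lt_or_ge 1 m with h1 | h1
  · left
    rcases sq_eq_sq_iff_eq_or_eq_neg.mp h with h | h
    · exact h ▸ pow_dvd_pow _ h1
    · exact (dvd_neg).mp (h ▸ pow_dvd_pow _ h1)
  · right
    obtain rfl : m = 1 := by omega
    rw [pow_one] at h
    exact ⟨rfl, sq_eq_sq_iff_eq_or_eq_neg.mp h.symm⟩

theorem solution_of_fst {m p q : ℕ} (hm : 0 < m) (hp : p.Prime) (hpo : Odd p) (hq : q.Prime)
    (h : ((q : ℤ) ^ m) ^ 2 = (gaussPair p).1 ^ 2) (x : ℤ)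
    (hx : x ^ 2 = (gaussPair p).2 ^ 2) (hxy : x ^ 2 + ((q : ℤ) ^ m) ^ 2 = 2 * 17 ^ p) : False := by
  have hn4 : p % 4 = 1 ∨ p % 4 = 3 := by rcases hpo with ⟨k, rfl⟩; omega
  have hp2 := hp.two_le
  rcases hn4 with h4 | h4
  · have hd := (gaussPair_dvd_fifteen p).1 h4
    obtain rfl := prime_eq_of_dvd_of_sq_eq hq Nat.prime_five h (by exact_mod_cast hd.1)
    rcases sq_dvd_or_eq_one hm h with h25 | ⟨-, h5⟩
    · have h5 := (five_dvd_of_twentyfive_dvd p).1 h4 (by norm_num at h25; exact h25)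
      obtain rfl := (Nat.prime_dvd_prime_iff_eq Nat.prime_five hp).mp h5
      -- The first entry at 5 is 1525 = 5² · 61.
      have : 61 = 5 := prime_eq_of_dvd_of_sq_eq hq (by norm_num) h (by decide)
      omega
    · have h16 := ((gaussPair_mod_sixteen p).1 h4).1
      have hS : (gaussPair p).1 = 5 := by push_cast at h5; omega
      have hne := (gaussPair_add_four_mul_ne 1 (k := p / 4) (by omega)).1
      rw [show 1 + 4 * (p / 4) = p by omega, hS] at hne
      exact hne (by decide)
  · have hd := (gaussPair_dvd_fifteen p).2 h4
    obtain rfl := prime_eq_of_dvd_of_sq_eq hq Nat.prime_three h (by exact_mod_cast hd.1)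
    rcases sq_dvd_or_eq_one hm h with h9 | ⟨rfl, -⟩
    · have h3 := (three_dvd_of_nine_dvd p).2 h4 (by norm_num at h9; exact h9)
      obtain rfl := (Nat.prime_dvd_prime_iff_eq Nat.prime_three hp).mp h3
      -- The first entry at 3 is 99 = 3² · 11.
      have : 11 = 3 := prime_eq_of_dvd_of_sq_eq hq (by norm_num) h (by decide)
      omega
    -- Non-recurrence does not apply, as the base value at 3 is 99, not 3. Instead, mod 5, x² + 9 ≡
    -- 4 while 2 · 17^p ≡ 1.
    · have h5x : (5 : ℤ) ∣ x ^ 2 := hx ▸ hd.2.trans (dvd_pow_self _ two_ne_zero)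
      have h17 : (17 : ℤ) ^ p ≡ 3 [ZMOD 5] := by
        rw [show p = 4 * (p / 4) + 3 by omega, pow_add, pow_mul]
        have : ((17 : ℤ) ^ 4) ^ (p / 4) ≡ 1 ^ (p / 4) [ZMOD 5] := Int.ModEq.pow _ (by decide)
        rw [one_pow] at this
        exact (this.mul_right _).trans (by decide)
      rw [Int.ModEq] at h17
      norm_num at hxy
      omega

theorem solution_of_snd {m p q : ℕ} (hm : 0 < m) (hp : p.Prime) (hpo : Odd p) (hq : q.Prime)
    (h : ((q : ℤ) ^ m) ^ 2 = (gaussPair p).2 ^ 2) : m = 1 ∧ p = 3 ∧ q = 5 := by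
  have hn4 : p % 4 = 1 ∨ p % 4 = 3 := by rcases hpo with ⟨k, rfl⟩; omega
  have hp2 := hp.two_le
  rcases hn4 with h4 | h4
  · exfalso
    have hd := (gaussPair_dvd_fifteen p).1 h4
    obtain rfl := prime_eq_of_dvd_of_sq_eq hq Nat.prime_three h (by exact_mod_cast hd.2)
    rcases sq_dvd_or_eq_one hm h with h9 | ⟨-, h3⟩
    · have h3 := (three_dvd_of_nine_dvd p).1 h4 (by norm_num at h9; exact h9)
      obtain rfl := (Nat.prime_dvd_prime_iff_eq Nat.prime_three hp).mp h3
      omega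
    · have h16 := ((gaussPair_mod_sixteen p).1 h4).2
      have hS : (gaussPair p).2 = 3 := by push_cast at h3; omega
      have hne := (gaussPair_add_four_mul_ne 1 (k := p / 4) (by omega)).2
      rw [show 1 + 4 * (p / 4) = p by omega, hS] at hne
      exact hne (by decide)
  · have hd := (gaussPair_dvd_fifteen p).2 h4
    obtain rfl := prime_eq_of_dvd_of_sq_eq hq Nat.prime_five h (by exact_mod_cast hd.2)
    rcases sq_dvd_or_eq_one hm h with h25 | ⟨hm1, h5⟩
    · have h5 := (five_dvd_of_twentyfive_dvd p).2 h4 (by norm_num at h25; exact h25)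
      obtain rfl := (Nat.prime_dvd_prime_iff_eq Nat.prime_five hp).mp h5
      omega
    · have h16 := ((gaussPair_mod_sixteen p).2 h4).2
      -- The residue 5 mod 16 rules out -5.
      have hS : (gaussPair p).2 = 5 := by push_cast at h5; omega
      refine ⟨hm1, ?_, rfl⟩
      by_contra hp3
      have hne := (gaussPair_add_four_mul_ne 3 (k := p / 4) (by omega)).2
      rw [show 3 + 4 * (p / 4) = p by omega, hS] at hne
      exact hne (by decide)

theorem mainTheorem6 (m p q x : ℕ) :
    (0 < m ∧ 0 < x ∧ p.Prime ∧ Odd p ∧ q.Prime ∧ Odd q ∧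
        x ^ 2 + q ^ (2 * m) = 2 * 17 ^ p) ↔
      (m = 1 ∧ p = 3 ∧ q = 5 ∧ x = 99) := by
  constructor
  · rintro ⟨hm, -, hp, hpo, hq, -, h⟩
    have hz : (x : ℤ) ^ 2 + ((q : ℤ) ^ m) ^ 2 = 2 * 17 ^ p := by
      rw [← pow_mul, mul_comm m 2]; exact_mod_cast h
    have hx : ¬ (17 : ℤ) ∣ x := by
      intro hd
      have h17 : (17 : ℤ) ∣ ((q : ℤ) ^ m) ^ 2 := by
        rw [← Int.dvd_add_right (hd.trans (dvd_pow_self _ two_ne_zero)), hz]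
        exact (dvd_pow_self _ hp.ne_zero).mul_left 2
      obtain rfl : 17 = q := prime_eq_of_dvd_of_sq_eq hq (by norm_num) rfl
        (by exact_mod_cast (show Prime (17 : ℤ) by norm_num).dvd_of_dvd_pow h17)
      exact sq_add_seventeen_pow_ne m x p hpo (by exact_mod_cast h)
    rcases sq_eq_gaussPair_sq hz hx with ⟨-, h2⟩ | ⟨h1, h2⟩
    · obtain ⟨rfl, rfl, rfl⟩ := solution_of_snd hm hp hpo hq h2
      refine ⟨rfl, rfl, rfl, ?_⟩
      norm_num at h
      nlinarith
    · exact (solution_of_fst hm hp hpo hq h2 x h1 hz).elim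
  · rintro ⟨rfl, rfl, rfl, rfl⟩
    refine ⟨by norm_num, by norm_num, by norm_num, by decide, by norm_num, by decide, by norm_num⟩
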